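/- Let $E\subseteq\mathbb{R}^n$ be an arbitrary subset and let $f:E\to\mathbb{R}$, $G:E\to\mathbb{R}^n$ be two functions. Put $Y:=\operatorname{span}\{G(x)-G(y): x,y\in E\}$ and, for a linear subspace $X\subseteq\mathbb{R}^n$, let $P_X:\mathbb{R}^n\to\mathbb{R}^n$ be the orthogonal projection onto $X$. There exists a convex function $F:\mathbb{R}^n\to\mathbb{R}$ of class $C^1$ such that $F|_E=f$ and $(\nabla F)|_E=G$ if and only if the following conditions (i) and (ii) hold and there exists a linear subspace $X\supseteq Y$ of $\mathbb{R}^n$ for which conditions (iii) and (iv) hold. (i) $G$ is continuous and $f(x)\ge f(y)+\langle G(y),x-y\rangle$ for all $x,y\in E$. (ii) If $(x_k)_k\subset E$ is a sequence with $\lim_{k\to\infty}|G(x_k)|=+\infty$, then $$\lim_{k\to\infty}\frac{\langle G(x_k),x_k\rangle-f(x_k)}{|G(x_k)|}=+\infty.$$ (iii) Either $X=Y$ or else, with $k=\dim Y$ and $d=\dim X$, there exist points $p_1,\dots,p_{d-k}\in\mathbb{R}^n\setminus\overline{E}$, numbers $\beta_1,\dots,\beta_{d-k}\in\mathbb{R}$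 and vectors $w_1,\dots,w_{d-k}\in\mathbb{R}^n$ such that (a) $X=\operatorname{span}\{u-v : u,v\in G(E)\cup\{w_1,\dots,w_{d-k}\}\}$; (b) $\beta_j>\max_{1\le i\ne j\le d-k}\{\beta_i+\langle w_i,p_j-p_i\rangle\}$ for all $1\le j\le d-k$; (c) $\beta_j>\sup_{z\in E,\,|G(z)|\le N}\{f(z)+\langle G(z),p_j-z\rangle\}$ for all $1\le j\le d-k$ and all $N\in\mathbb{N}$; (d) $\inf_{x\in E,\,|P_X(x)|\le N}\bigl\{f(x)-\max_{1\le j\le d-k}\{\beta_j+\langle w_j,x-p_j\rangle\}\bigr\}>0$ for all $N\in\mathbb{N}$. (iv) If $(x_k)_k,(z_k)_k$ are sequences in $E$ such that $(P_X(x_k))_k$ and $(G(z_k))_k$ are bounded and $$\lim_{k\to\infty}\bigl(f(x_k)-f(z_k)-\langle G(z_k),x_k-z_k\rangle\bigr)=0,$$ then $\lim_{k\to\infty}|G(x_k)-G(z_k)|=0$. (Maxima and suprema over empty families are $-\infty$, infima over empty families are $+\infty$.) -/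

import Mathlib

open Filter Topology Set

open scoped InnerProductSpace

noncomputable section

namespace ConvexJet

variable {n : ℕ} {E : Set (EuclideanSpace ℝ (Fin n))}

/-- The 1-jet `(f, G)` on `E` is the restriction of `(F, ∇F)` for some convex
`F : ℝⁿ → ℝ` of class `C¹`. -/
def HasConvexC1Extension (f : E → ℝ) (G : E → EuclideanSpace ℝ (Fin n)) : Prop :=
  ∃ F : EuclideanSpace ℝ (Fin n) → ℝ,
    ConvexOn ℝ univ F ∧ ContDiff ℝ 1 F ∧
      (∀ x : E, F x = f x) ∧ (∀ x : E, gradient F (x : EuclideanSpace ℝ (Fin n)) = G x)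

/-- The first order convexity inequality for a jet. -/
def ConvexityIneq (f : E → ℝ) (G : E → EuclideanSpace ℝ (Fin n)) : Prop :=
  ∀ x y : E, f y + ⟪G y, (x : EuclideanSpace ℝ (Fin n)) - y⟫_ℝ ≤ f x

/-- Condition (EX). -/
def CondEX (f : E → ℝ) (G : E → EuclideanSpace ℝ (Fin n)) : Prop :=
  ∀ x : ℕ → E, Tendsto (fun k => ‖G (x k)‖) atTop atTop →
    Tendsto (fun k => (⟪G (x k), (x k : EuclideanSpace ℝ (Fin n))⟫_ℝ - f (x k)) / ‖G (x k)‖)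
      atTop atTop

/-- The linear span of all differences of elements of `S`. -/
def diffSpan (S : Set (EuclideanSpace ℝ (Fin n))) : Submodule ℝ (EuclideanSpace ℝ (Fin n)) :=
  Submodule.span ℝ {a | ∃ u ∈ S, ∃ v ∈ S, a = u - v}

/-- The conditions (a)-(d) on `m` additional jets `(p j, β j, w j)`, with `p j` outside the
closure of `E`, relative to the subspace `X`.  The supremum in (c) and the infimum in (d) over
points of `E` are extended-real valued, so that they are the usual ones also for empty or
unbounded families; the inner supremum in (d), over `Fin m`, is a maximum of finitely many
real numbers (the notion is only used with `m > 0`). -/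
structure AddedJets (f : E → ℝ) (G : E → EuclideanSpace ℝ (Fin n))
    (X : Submodule ℝ (EuclideanSpace ℝ (Fin n))) {m : ℕ}
    (p : Fin m → EuclideanSpace ℝ (Fin n)) (β : Fin m → ℝ)
    (w : Fin m → EuclideanSpace ℝ (Fin n)) : Prop where
  notMem_closure : ∀ j, p j ∉ closure E
  cond_a : X = diffSpan (range G ∪ range w)
  cond_b : ∀ j i, i ≠ j → β i + ⟪w i, p j - p i⟫_ℝ < β j
  cond_c : ∀ (j : Fin m) (N : ℕ),
    (⨆ z : {z : E // ‖G z‖ ≤ N},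
      ((f z + ⟪G z, p j - (z : E)⟫_ℝ : ℝ) : EReal)) < (β j : EReal)
  cond_d : ∀ N : ℕ,
    (0 : EReal) < ⨅ x : {x : E // ‖X.starProjection (x : EuclideanSpace ℝ (Fin n))‖ ≤ N},
      ((f x - ⨆ j : Fin m, (β j + ⟪w j, ((x : E) : EuclideanSpace ℝ (Fin n)) - p j⟫_ℝ) : ℝ) :
        EReal)

/-- The subspace `X` contains `Y = span {G x - G y : x, y ∈ E}` and either equals `Y` or is
generated with the help of `dim X - dim Y` added jets.  (If `Y ≤ X` and `Y ≠ X`, then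
`dim X - dim Y` is a positive natural number.) -/
def AdmissibleSubspace (f : E → ℝ) (G : E → EuclideanSpace ℝ (Fin n))
    (X : Submodule ℝ (EuclideanSpace ℝ (Fin n))) : Prop :=
  diffSpan (range G) ≤ X ∧
    (diffSpan (range G) = X ∨
      ∃ (p : Fin (Module.finrank ℝ X - Module.finrank ℝ (diffSpan (range G))) →
            EuclideanSpace ℝ (Fin n))
        (β : Fin (Module.finrank ℝ X - Module.finrank ℝ (diffSpan (range G))) → ℝ)
        (w : Fin (Module.finrank ℝ X - Module.finrank ℝ (diffSpan (range G))) →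
            EuclideanSpace ℝ (Fin n)),
        AddedJets f G X p β w)

/-- The sequential condition relative to the orthogonal projection onto `X`. -/
def SequentialCW1 (f : E → ℝ) (G : E → EuclideanSpace ℝ (Fin n))
    (X : Submodule ℝ (EuclideanSpace ℝ (Fin n))) : Prop :=
  ∀ x z : ℕ → E,
    Bornology.IsBounded (range fun k => X.starProjection (x k : EuclideanSpace ℝ (Fin n))) →
    Bornology.IsBounded (range fun k => G (z k)) →
    Tendsto (fun k => f (x k) - f (z k) -
      ⟪G (z k), (x k : EuclideanSpace ℝ (Fin n)) - z k⟫_ℝ) atTop (𝓝 0) →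
    Tendsto (fun k => ‖G (x k) - G (z k)‖) atTop (𝓝 0)

end ConvexJet

end

/-! Sufficiency. Subtracting a linear function of slope `v = G e₀` and projecting orthogonally moves
the problem into `X`, where by (a) the differences of the slopes span. Let `m` be the supremum of
the affine functions of all jets, original and added. Condition (ii) makes `m` finite; (i) and (d)
give it the prescribed values on the projected set; (iv) and (d) make it differentiable on the
closure `C` of that set (`differentiableAt_supAffine`). Off `C` it may have corners, so it is
replaced by a differentiable majorant that agrees with it on `C` (`exists_differentiable_ge_eqOn`),
and this by its convex envelope. The envelope is trapped between `m` and the majorant, hence keeps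
values and supports on the projected set. It is `C¹` because the spanning slopes make the majorant
coercive up to a linear function (`exists_coercive_affine`, `contDiff_convexEnvelope`).

Necessity. Let `X` be the span of all gradient differences of `F`. Along `Xᗮ` the function `F` is
affine with a fixed slope, so only the projection of a point to `X` matters, and compactness in `X`
gives (iv) (`tendsto_gradient_sub`). The added jets are those of `F` at points whose gradients,
recentred at one taken on `E`, form a basis of `X` modulo `Y`. If (c), (d) or `p j ∉ closure E`
failed, gradients on `E` would converge to the gradient at some `p j`, which is impossible since `Y`
is closed. -/

namespace ConvexJet

/-! ### Differentiability of convex functions and convex envelopes. -/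

section Convex

variable {W : Type*} [NormedAddCommGroup W] [NormedSpace ℝ W]

/-- A convex function touched from above at `x` by a function differentiable at `x` is itself
differentiable at `x`. -/
theorem differentiableAt_of_convexOn_of_le {F u : W → ℝ} (hF : ConvexOn ℝ univ F) {x : W}
    (hle : ∀ y, F y ≤ u y) (heq : F x = u x) (hu : DifferentiableAt ℝ u x) :
    DifferentiableAt ℝ F x := by
  have hd := hu.hasFDerivAt
  set L := fderiv ℝ u x
  suffices HasFDerivAt F L x from this.differentiableAt
  rw [hasFDerivAt_iff_isLittleO_nhds_zero, Asymptotics.isLittleO_iff] at hd ⊢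
  intro c hc
  have h1 := hd hc
  have h2 : ∀ᶠ h : W in 𝓝 0, ‖u (x + -h) - u x - L (-h)‖ ≤ c * ‖-h‖ :=
    (by simpa using (continuous_neg (G := W)).tendsto 0 : Tendsto (fun h : W => -h) (𝓝 0) (𝓝 0))
      |>.eventually h1
  filter_upwards [h1, h2] with h h1 h2
  -- Midpoint convexity turns the upper bound at `x - h` into the missing lower bound at `x + h`.
  have hmid : F x ≤ (1 / 2) * F (x + h) + (1 / 2) * F (x + -h) := by
    have := hF.2 (mem_univ (x + h)) (mem_univ (x + -h)) (show (0 : ℝ) ≤ 1 / 2 by norm_num)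
      (show (0 : ℝ) ≤ 1 / 2 by norm_num) (by norm_num)
    have hx : (1 / 2 : ℝ) • (x + h) + (1 / 2 : ℝ) • (x + -h) = x := by module
    rwa [hx] at this
  rw [Real.norm_eq_abs, abs_le] at h1 h2 ⊢
  rw [norm_neg, map_neg] at h2
  have := hle (x + h)
  have := hle (x + -h)
  constructor <;> linarith [h1.1, h1.2, h2.1, h2.2]

/-- The gradient inequality for convex functions. -/
theorem add_fderiv_le_of_convexOn {F : W → ℝ} (hF : ConvexOn ℝ univ F) {x : W}
    (hd : DifferentiableAt ℝ F x) (y : W) : F x + fderiv ℝ F x (y - x) ≤ F y := by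
  have hl : HasDerivAt (fun t : ℝ => F (x + t • (y - x))) (fderiv ℝ F x (y - x)) 0 := by
    have h0 : HasFDerivAt F (fderiv ℝ F x) (x + (0 : ℝ) • (y - x)) := by
      simpa using hd.hasFDerivAt
    have h1 : HasDerivAt (fun t : ℝ => x + t • (y - x)) (y - x) 0 := by
      simpa using ((hasDerivAt_id (0 : ℝ)).smul_const (y - x)).const_add x
    exact h0.comp_hasDerivAt (0 : ℝ) h1
  have ht := hl.tendsto_slope_zero_right
  have hb : fderiv ℝ F x (y - x) ≤ F y - F x := by
    refine le_of_tendsto ht ?_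
    filter_upwards [Ioc_mem_nhdsGT (zero_lt_one (α := ℝ))] with t ht
    have := hF.2 (mem_univ x) (mem_univ y) (show 0 ≤ 1 - t by linarith [ht.2]) ht.1.le (by ring)
    have hx : (1 - t) • x + t • y = x + t • (y - x) := by module
    rw [hx] at this
    simp only [zero_add, zero_smul, add_zero, smul_eq_mul] at this ⊢
    rw [inv_mul_le_iff₀ ht.1]
    linarith
  linarith

/-- An everywhere differentiable convex function is of class `C¹`. -/
theorem contDiff_one_of_convexOn {F : W → ℝ} (hF : ConvexOn ℝ univ F)
    (hd : Differentiable ℝ F) : ContDiff ℝ 1 F := by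
  rw [contDiff_one_iff_fderiv]
  refine ⟨hd, continuous_iff_continuousAt.2 fun x => ?_⟩
  rw [Metric.continuousAt_iff]
  intro ε hε
  have hx := (hd x).hasFDerivAt
  rw [hasFDerivAt_iff_isLittleO_nhds_zero, Asymptotics.isLittleO_iff] at hx
  obtain ⟨r, hr, hball⟩ := Metric.eventually_nhds_iff.1 (hx (show 0 < ε / 4 by positivity))
  refine ⟨r / 3, by positivity, fun {y} hy => ?_⟩
  rw [dist_eq_norm] at hy ⊢
  -- The tangent at `y` is compared with the expansion at `x` at the point `y + (r / 3) • u`, which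
  -- lies within `2 * (r / 3) < r` of `x`.
  have key : ∀ u : W, ‖u‖ = 1 → (fderiv ℝ F y - fderiv ℝ F x) u ≤ ε / 2 := by
    intro u hu
    have h1 := add_fderiv_le_of_convexOn hF (hd y) (y + (r / 3) • u)
    have h2 := add_fderiv_le_of_convexOn hF (hd x) y
    have hn : ‖y - x + (r / 3) • u‖ ≤ 2 * (r / 3) := by
      refine (norm_add_le _ _).trans ?_
      rw [norm_smul, hu, Real.norm_of_nonneg (by positivity)]
      linarith
    have h3 := hball (y := y - x + (r / 3) • u) (by rw [dist_zero_right]; linarith)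
    rw [Real.norm_eq_abs] at h3
    have h4 := (le_abs_self _).trans h3
    have hxy : x + (y - x + (r / 3) • u) = y + (r / 3) • u := by abel
    rw [hxy] at h4
    simp only [add_sub_cancel_left, map_smul, map_add, smul_eq_mul] at h1 h4
    have h5 : ε / 4 * ‖y - x + (r / 3) • u‖ ≤ ε / 4 * (2 * (r / 3)) := by gcongr
    have h6 : (r / 3) * (fderiv ℝ F y u - fderiv ℝ F x u) ≤ (r / 3) * (ε / 2) := by linarith
    exact le_of_mul_le_mul_left h6 (by positivity)
  have hnorm : ‖fderiv ℝ F y - fderiv ℝ F x‖ ≤ ε / 2 := by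
    refine ContinuousLinearMap.opNorm_le_of_unit_norm (by positivity) fun u hu => ?_
    rw [Real.norm_eq_abs, abs_le]
    have := key (-u) (by rwa [norm_neg])
    rw [map_neg] at this
    exact ⟨by linarith, key u hu⟩
  linarith

/-- The epigraph of a function. -/
def epigraph (g : W → ℝ) : Set (W × ℝ) := {q | g q.1 ≤ q.2}

/-- The convex envelope of a function which is bounded below. -/
noncomputable def convexEnvelope (g : W → ℝ) (x : W) : ℝ :=
  sInf {t | (x, t) ∈ convexHull ℝ (epigraph g)}

theorem self_mem_convexHull_epigraph (g : W → ℝ) (x : W) :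
    (x, g x) ∈ convexHull ℝ (epigraph g) :=
  subset_convexHull ℝ _ (le_refl (g x))

theorem le_of_mem_convexHull_epigraph {m g : W → ℝ} (hm : ConvexOn ℝ univ m)
    (hmg : ∀ x, m x ≤ g x) {q : W × ℝ} (hq : q ∈ convexHull ℝ (epigraph g)) : m q.1 ≤ q.2 := by
  have h : convexHull ℝ (epigraph g) ⊆ {q : W × ℝ | q.1 ∈ univ ∧ m q.1 ≤ q.2} :=
    convexHull_min (fun q hq => ⟨mem_univ _, (hmg q.1).trans hq⟩) hm.convex_epigraph
  exact (h hq).2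

theorem le_convexEnvelope {m g : W → ℝ} (hm : ConvexOn ℝ univ m) (hmg : ∀ x, m x ≤ g x) (x : W) :
    m x ≤ convexEnvelope g x :=
  le_csInf ⟨_, self_mem_convexHull_epigraph g x⟩
    fun _ ht => le_of_mem_convexHull_epigraph hm hmg ht

theorem le_of_mem_convexHull_epigraph_of_le {g : W → ℝ} {b : ℝ} (hb : ∀ x, b ≤ g x) {q : W × ℝ}
    (hq : q ∈ convexHull ℝ (epigraph g)) : b ≤ q.2 :=
  le_of_mem_convexHull_epigraph (m := fun _ => b) (convexOn_const b convex_univ) hb hq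

theorem convexEnvelope_le_of_mem {g : W → ℝ} {b : ℝ} (hb : ∀ x, b ≤ g x) {x : W} {t : ℝ}
    (ht : (x, t) ∈ convexHull ℝ (epigraph g)) : convexEnvelope g x ≤ t :=
  csInf_le ⟨b, fun _ hs => le_of_mem_convexHull_epigraph_of_le hb hs⟩ ht

theorem convexEnvelope_le {g : W → ℝ} {b : ℝ} (hb : ∀ x, b ≤ g x) (x : W) :
    convexEnvelope g x ≤ g x :=
  convexEnvelope_le_of_mem hb (self_mem_convexHull_epigraph g x)

theorem exists_mem_lt_convexEnvelope_add (g : W → ℝ) (x : W) {ε : ℝ} (hε : 0 < ε) :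
    ∃ t, (x, t) ∈ convexHull ℝ (epigraph g) ∧ t < convexEnvelope g x + ε :=
  exists_lt_of_csInf_lt ⟨_, self_mem_convexHull_epigraph g x⟩
    (show convexEnvelope g x < _ by linarith)

theorem convexOn_convexEnvelope {g : W → ℝ} {b : ℝ} (hb : ∀ x, b ≤ g x) :
    ConvexOn ℝ univ (convexEnvelope g) := by
  refine ⟨convex_univ, fun x _ y _ α γ hα hγ hαγ => ?_⟩
  refine le_of_forall_pos_le_add fun ε hε => ?_
  obtain ⟨s, hs, hs'⟩ := exists_mem_lt_convexEnvelope_add g x hε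
  obtain ⟨t, ht, ht'⟩ := exists_mem_lt_convexEnvelope_add g y hε
  have h := convexEnvelope_le_of_mem hb
    (x := α • x + γ • y) (t := α * s + γ * t) (convex_convexHull ℝ _ hs ht hα hγ hαγ)
  have h1 : α * s ≤ α * (convexEnvelope g x + ε) := by gcongr
  have h2 : γ * t ≤ γ * (convexEnvelope g y + ε) := by gcongr
  simp only [smul_eq_mul]
  have : α * ε + γ * ε = ε := by rw [← add_mul, hαγ, one_mul]
  linarith

end Convex

/-! ### A quantitative form of Carathéodory's theorem. -/

section Caratheodory

variable {V : Type*} [AddCommGroup V] [Module ℝ V] [FiniteDimensional ℝ V]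

/-- A point of a convex hull in a finite dimensional space is a convex combination of a point of
the set and a point of the hull, in which the former has a weight bounded below. -/
theorem exists_large_weight_of_mem_convexHull {S : Set V} {q : V} (hq : q ∈ convexHull ℝ S) :
    ∃ θ : ℝ, ((Module.finrank ℝ V : ℝ) + 1)⁻¹ ≤ θ ∧ θ ≤ 1 ∧ ∃ p ∈ S, ∃ r ∈ convexHull ℝ S,
      q = θ • p + (1 - θ) • r := by
  classical
  obtain ⟨ι, _, z, w, hz, hind, hw, hsum, rfl⟩ := eq_pos_convex_span_of_mem_convexHull hq
  have hcard : Fintype.card ι ≤ Module.finrank ℝ V + 1 :=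
    hind.card_le_finrank_succ.trans (by gcongr; exact Submodule.finrank_le _)
  have hne : (Finset.univ : Finset ι).Nonempty := by
    by_contra h
    rw [Finset.not_nonempty_iff_eq_empty] at h
    rw [h, Finset.sum_empty] at hsum
    exact zero_ne_one hsum
  -- Pigeonhole: at most `finrank + 1` weights sum to one.
  obtain ⟨i, -, hi⟩ := Finset.exists_le_of_sum_le (s := Finset.univ)
    (f := fun _ : ι => ((Module.finrank ℝ V : ℝ) + 1)⁻¹) (g := w) hne (by
      rw [hsum, Finset.sum_const, nsmul_eq_mul, Finset.card_univ, mul_inv_le_iff₀ (by positivity),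
        one_mul]
      exact_mod_cast hcard)
  have hsplit := Finset.add_sum_erase Finset.univ w (Finset.mem_univ i)
  rw [hsum] at hsplit
  have hsplit' := Finset.add_sum_erase Finset.univ (fun j => w j • z j) (Finset.mem_univ i)
  have hnn : ∀ j ∈ Finset.univ.erase i, 0 ≤ w j := fun j _ => (hw j).le
  have hle : w i ≤ 1 := by linarith [Finset.sum_nonneg hnn]
  refine ⟨w i, hi, hle, z i, hz ⟨i, rfl⟩, ?_⟩
  rcases hle.eq_or_lt with h1 | h1
  · refine ⟨z i, subset_convexHull ℝ _ (hz ⟨i, rfl⟩), ?_⟩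
    have h0 : ∑ j ∈ Finset.univ.erase i, w j = 0 := by linarith
    rw [Finset.sum_eq_zero_iff_of_nonneg hnn] at h0
    rw [← hsplit', Finset.sum_eq_zero fun j hj => by rw [h0 j hj, zero_smul], h1]
    simp
  · have hpos : 0 < ∑ j ∈ Finset.univ.erase i, w j := by linarith
    refine ⟨(Finset.univ.erase i).centerMass w z,
      Finset.centerMass_mem_convexHull _ hnn hpos fun j _ => hz ⟨j, rfl⟩, ?_⟩
    rw [← hsplit', Finset.centerMass, smul_smul,
      show 1 - w i = ∑ j ∈ Finset.univ.erase i, w j by linarith, mul_inv_cancel₀ hpos.ne', one_smul]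

end Caratheodory

/-! ### Smoothness of the convex envelope. -/

section Envelope

variable {W : Type*} [NormedAddCommGroup W] [NormedSpace ℝ W] [FiniteDimensional ℝ W]

/-- In a nearly optimal combination `x = θ • p + (1 - θ) • r`, moving `p` alone by `θ⁻¹ • h` moves
`x` by `h`, so increments of `g` at `p` control those of the envelope. Since `θ` is bounded below,
coercivity bounds `p`, and a limit of such combinations removes the error. The resulting majorant
touches the envelope at `x` and is differentiable if `g` is. -/
theorem exists_le_convexEnvelope_add {g : W → ℝ} (hg : Continuous g) {c b : ℝ} (hc : 0 < c)
    (hcoer : ∀ x, c * ‖x‖ + b ≤ g x) (x : W) :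
    ∃ (p : W) (θ : ℝ), 0 < θ ∧
      ∀ h, convexEnvelope g (x + h) ≤ convexEnvelope g x + θ * (g (p + θ⁻¹ • h) - g p) := by
  have hb : ∀ x, b ≤ g x := fun x => by
    have := hcoer x
    have : 0 ≤ c * ‖x‖ := by positivity
    linarith
  set D : ℝ := (Module.finrank ℝ (W × ℝ) : ℝ) + 1 with hD
  have hDpos : 0 < D := by positivity
  have step : ∀ k : ℕ, ∃ q : W × ℝ, q.2 ∈ Icc D⁻¹ 1 ∧
      ‖q.1‖ ≤ (convexEnvelope g x + 1 - b) * D / c ∧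
      ∀ h, convexEnvelope g (x + h) ≤
        convexEnvelope g x + 1 / ((k : ℝ) + 1) + q.2 * (g (q.1 + q.2⁻¹ • h) - g q.1) := by
    intro k
    obtain ⟨t, ht, htlt⟩ := exists_mem_lt_convexEnvelope_add g x (Nat.one_div_pos_of_nat (n := k))
    obtain ⟨θ, hθ, hθ1, ⟨p, s⟩, hps, ⟨r, l⟩, hr, heq⟩ := exists_large_weight_of_mem_convexHull ht
    have hθpos : 0 < θ := (inv_pos.2 hDpos).trans_le hθ
    have hps : g p ≤ s := hps
    simp only [Prod.smul_mk, Prod.mk_add_mk, Prod.mk.injEq, smul_eq_mul] at heq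
    obtain ⟨hx, ht'⟩ := heq
    refine ⟨(p, θ), ⟨hθ, hθ1⟩, ?_, fun h => ?_⟩
    · have hl : b ≤ l := le_of_mem_convexHull_epigraph_of_le hb hr
      have h1 : (1 - θ) * b ≤ (1 - θ) * l := by
        have : 0 ≤ 1 - θ := by linarith
        gcongr
      have h2 : θ * (c * ‖p‖ + b) ≤ θ * s := by
        have := (hcoer p).trans hps
        gcongr
      have h3 : (1 : ℝ) / ((k : ℝ) + 1) ≤ 1 := by
        rw [div_le_one (by positivity)]
        linarith [Nat.cast_nonneg (α := ℝ) k]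
      have h4 : θ * (c * ‖p‖) ≤ convexEnvelope g x + 1 - b := by linarith
      have h5 : D⁻¹ * (c * ‖p‖) ≤ θ * (c * ‖p‖) := by gcongr
      have h6 := h5.trans h4
      rw [inv_mul_le_iff₀ hDpos] at h6
      rw [le_div_iff₀ hc]
      linarith
    · have hmem : (x + h, θ * g (p + θ⁻¹ • h) + (1 - θ) * l) ∈ convexHull ℝ (epigraph g) := by
        have := convex_convexHull ℝ (epigraph g) (self_mem_convexHull_epigraph g (p + θ⁻¹ • h)) hr
          hθpos.le (show 0 ≤ 1 - θ by linarith) (by ring)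
        convert this using 1
        ext
        · simp only [Prod.smul_mk, Prod.mk_add_mk, smul_add, smul_inv_smul₀ hθpos.ne']
          rw [hx]; abel
        · simp
      have h1 := convexEnvelope_le_of_mem hb hmem
      have h2 : θ * g p ≤ θ * s := by gcongr
      simp only
      linarith
  choose q hq1 hq2 hq3 using step
  have hK : IsCompact (Metric.closedBall (0 : W) ((convexEnvelope g x + 1 - b) * D / c) ×ˢ
      Icc D⁻¹ 1) := (isCompact_closedBall _ _).prod isCompact_Icc
  obtain ⟨⟨p, θ⟩, hmem, φ, hφ, hlim⟩ := hK.tendsto_subseq (x := q) fun k =>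
    ⟨by simpa using hq2 k, hq1 k⟩
  have hθ : 0 < θ := (inv_pos.2 hDpos).trans_le hmem.2.1
  refine ⟨p, θ, hθ, fun h => ?_⟩
  have hl1 : Tendsto (fun k => (q (φ k)).1) atTop (𝓝 p) := (continuous_fst.tendsto _).comp hlim
  have hl2 : Tendsto (fun k => (q (φ k)).2) atTop (𝓝 θ) := (continuous_snd.tendsto _).comp hlim
  have hl3 : Tendsto (fun k => (1 : ℝ) / ((φ k : ℕ) + 1)) atTop (𝓝 0) :=
    tendsto_one_div_add_atTop_nhds_zero_nat.comp hφ.tendsto_atTop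
  have hl4 : Tendsto (fun k => g ((q (φ k)).1 + (q (φ k)).2⁻¹ • h)) atTop (𝓝 (g (p + θ⁻¹ • h))) :=
    (hg.tendsto _).comp (hl1.add ((hl2.inv₀ hθ.ne').smul_const h))
  have hl5 : Tendsto (fun k => g (q (φ k)).1) atTop (𝓝 (g p)) := (hg.tendsto _).comp hl1
  have hl := (hl3.const_add (convexEnvelope g x)).add (hl2.mul (hl4.sub hl5))
  rw [add_zero] at hl
  exact ge_of_tendsto' hl fun k => hq3 (φ k) h

/-- The convex envelope of a coercive differentiable function is of class `C¹`. -/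
theorem contDiff_convexEnvelope {g : W → ℝ} (hg : Differentiable ℝ g) {c b : ℝ} (hc : 0 < c)
    (hcoer : ∀ x, c * ‖x‖ + b ≤ g x) : ContDiff ℝ 1 (convexEnvelope g) := by
  have hb : ∀ x, b ≤ g x := fun x => by
    have := hcoer x
    have : 0 ≤ c * ‖x‖ := by positivity
    linarith
  have hconv := convexOn_convexEnvelope hb
  refine contDiff_one_of_convexOn hconv fun x => ?_
  obtain ⟨p, θ, hθ, h⟩ := exists_le_convexEnvelope_add hg.continuous hc hcoer x
  refine differentiableAt_of_convexOn_of_le (x := x)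
    (u := fun y => convexEnvelope g x + θ * (g (p + θ⁻¹ • (y - x)) - g p)) hconv
    (fun y => by simpa using h (y - x)) (by simp) ?_
  fun_prop

end Envelope

/-! ### Differentiable majorants with prescribed contact set. -/

section Smoothing

open scoped Manifold ContDiff

variable {W : Type*} [NormedAddCommGroup W] [NormedSpace ℝ W] [FiniteDimensional ℝ W]

/-- A continuous function which is differentiable at the points of a closed set `C` has an
everywhere differentiable majorant which agrees with it on `C`. -/
theorem exists_differentiable_ge_eqOn {m : W → ℝ} (hm : Continuous m) {C : Set W}
    (hC : IsClosed C) (hne : C.Nonempty) (hd : ∀ c ∈ C, DifferentiableAt ℝ m c) :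
    ∃ g : W → ℝ, Differentiable ℝ g ∧ (∀ x, m x ≤ g x) ∧ ∀ c ∈ C, g c = m c := by
  classical
  let U : TopologicalSpace.Opens W := ⟨Cᶜ, hC.isOpen_compl⟩
  have hdist : Continuous fun x : U => Metric.infDist (x : W) C ^ 2 / 2 :=
    (((Metric.continuous_infDist_pt C).comp continuous_subtype_val).pow 2).div_const 2
  have hpos : ∀ x : U, 0 < Metric.infDist (x : W) C ^ 2 / 2 := fun x => by
    have : 0 < Metric.infDist (x : W) C := (hC.notMem_iff_infDist_pos hne).1 x.2
    positivity
  have : ProperSpace W := FiniteDimensional.proper ℝ W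
  have : LocallyCompactSpace U := U.isOpen.locallyCompactSpace
  have : SigmaCompactSpace U := inferInstance
  -- With `d` the distance to `C`, approximating `m + d ^ 2 / 2` within `d ^ 2 / 2` gives `m ≤ g ≤ m
  -- + d ^ 2`. The quadratic gap preserves the derivative on `C`.
  obtain ⟨s, hs, -⟩ := Continuous.exists_contMDiff_approx (M := U) 𝓘(ℝ, W) 1
    (f := fun x : U => m x + Metric.infDist (x : W) C ^ 2 / 2)
    ((hm.comp continuous_subtype_val).add hdist) hdist hpos
  let g : W → ℝ := fun x => if h : x ∈ U then s ⟨x, h⟩ else m x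
  have hgU : ∀ x : U, g x = s x := fun x => dif_pos x.2
  have hgC : ∀ x ∈ C, g x = m x := fun x hx => dif_neg fun h => h hx
  have hbounds : ∀ x, m x ≤ g x ∧ g x ≤ m x + Metric.infDist x C ^ 2 := by
    intro x
    by_cases hx : x ∈ C
    · rw [hgC x hx]
      exact ⟨le_rfl, by have := sq_nonneg (Metric.infDist x C); linarith⟩
    · have h := hs ⟨x, hx⟩
      rw [← hgU ⟨x, hx⟩, Real.dist_eq, abs_lt] at h
      simp only at h
      exact ⟨by linarith [h.1], by linarith [h.2]⟩
  refine ⟨g, fun x => ?_, fun x => (hbounds x).1, hgC⟩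
  by_cases hx : x ∈ C
  · have hO : (fun y => g y - m y) =O[𝓝 x] fun y => ‖y - x‖ ^ 2 := by
      refine Asymptotics.IsBigO.of_bound 1 (Eventually.of_forall fun y => ?_)
      have h1 := hbounds y
      have h2 : Metric.infDist y C ≤ ‖y - x‖ := by
        rw [← dist_eq_norm]; exact Metric.infDist_le_dist_of_mem hx
      have h3 : Metric.infDist y C ^ 2 ≤ ‖y - x‖ ^ 2 :=
        pow_le_pow_left₀ Metric.infDist_nonneg h2 2
      rw [Real.norm_of_nonneg (by linarith [h1.1]), Real.norm_of_nonneg (by positivity)]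
      linarith [h1.2]
    have h := (hO.hasFDerivAt one_lt_two).differentiableAt.add (hd x hx)
    refine h.congr_of_eventuallyEq (Eventually.of_forall fun y => ?_)
    simp
  · have h1 : ContMDiffAt 𝓘(ℝ, W) 𝓘(ℝ, ℝ) 1 (fun y : U => g y) ⟨x, hx⟩ := by
      simp only [hgU]
      exact s.contMDiff.contMDiffAt
    have h2 := contMDiffAt_subtype_iff.1 h1
    exact (contMDiffAt_iff_contDiffAt.1 h2).differentiableAt one_ne_zero

end Smoothing

/-! ### Suprema of affine functions and extension under a spanning condition. -/

section Affine

variable {W : Type*} [NormedAddCommGroup W] [InnerProductSpace ℝ W] {I J : Type*}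

/-- The supremum of the affine functions `y ↦ a j + ⟪g j, y⟫`. -/
noncomputable def supAffine (a : J → ℝ) (g : J → W) (y : W) : ℝ := ⨆ j, (a j + ⟪g j, y⟫_ℝ)

variable {a : J → ℝ} {g : J → W} {x : I → W} {σ : I → J}

theorem convexOn_supAffine [Nonempty J] (hb : ∀ y, BddAbove (range fun j => a j + ⟪g j, y⟫_ℝ)) :
    ConvexOn ℝ univ (supAffine a g) := by
  refine ⟨convex_univ, fun y _ z _ α γ hα hγ hαγ => ciSup_le fun j => ?_⟩
  have h1 : α * (a j + ⟪g j, y⟫_ℝ) ≤ α * supAffine a g y := by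
    gcongr; exact le_ciSup (hb y) j
  have h2 : γ * (a j + ⟪g j, z⟫_ℝ) ≤ γ * supAffine a g z := by
    gcongr; exact le_ciSup (hb z) j
  have h3 : α * a j + γ * a j = a j := by rw [← add_mul, hαγ, one_mul]
  simp only [smul_eq_mul, inner_add_right, inner_smul_right]
  linarith

/-- If the slopes go to infinity slower than the negatives of the constant terms, then affine
functions of large slope are very negative on bounded sets. -/
theorem exists_affine_le_of_large_slope
    (hex : ∀ R : ℝ, ∃ M : ℝ, ∀ j, M ≤ ‖g j‖ → a j ≤ -R * ‖g j‖) (R T : ℝ) :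
    ∃ M : ℝ, 0 ≤ M ∧ ∀ j, M ≤ ‖g j‖ → ∀ y, ‖y‖ ≤ R → a j + ⟪g j, y⟫_ℝ ≤ T := by
  obtain ⟨M, hM⟩ := hex (R + 1)
  refine ⟨max (max M (-T)) 0, le_max_right _ _, fun j hj y hy => ?_⟩
  have h1 := hM j ((le_max_left _ _).trans ((le_max_left _ _).trans hj))
  have h2 : -T ≤ ‖g j‖ := (le_max_right _ _).trans ((le_max_left _ _).trans hj)
  have h3 := real_inner_le_norm (g j) y
  have h4 : ‖g j‖ * ‖y‖ ≤ ‖g j‖ * R := by gcongr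
  linarith

/-- Steep members are nonpositive at `y` by the growth condition; the others have slopes at most `M`
and are controlled from their values at `x₀`. -/
theorem bddAbove_affine (hex : ∀ R : ℝ, ∃ M : ℝ, ∀ j, M ≤ ‖g j‖ → a j ≤ -R * ‖g j‖)
    {x₀ : W} {T : ℝ} (h₀ : ∀ j, a j + ⟪g j, x₀⟫_ℝ ≤ T) (y : W) :
    BddAbove (range fun j => a j + ⟪g j, y⟫_ℝ) := by
  obtain ⟨M, hM0, hM⟩ := exists_affine_le_of_large_slope hex ‖y‖ 0
  refine ⟨max 0 (T + M * ‖y - x₀‖), ?_⟩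
  rintro _ ⟨j, rfl⟩
  rcases le_total M ‖g j‖ with h | h
  · exact (hM j h y le_rfl).trans (le_max_left _ _)
  · refine le_trans ?_ (le_max_right _ _)
    have h1 := h₀ j
    have h2 := real_inner_le_norm (g j) (y - x₀)
    have h3 : ‖g j‖ * ‖y - x₀‖ ≤ M * ‖y - x₀‖ := by gcongr
    rw [inner_sub_right] at h2
    simp only
    linarith

theorem supAffine_eq (hmax : ∀ i j, a j + ⟪g j, x i⟫_ℝ ≤ a (σ i) + ⟪g (σ i), x i⟫_ℝ) (i : I) :
    supAffine a g (x i) = a (σ i) + ⟪g (σ i), x i⟫_ℝ :=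
  have : Nonempty J := ⟨σ i⟩
  le_antisymm (ciSup_le fun j => hmax i j)
    (le_ciSup (f := fun j => a j + ⟪g j, x i⟫_ℝ) ⟨_, by rintro _ ⟨j, rfl⟩; exact hmax i j⟩ (σ i))

variable [FiniteDimensional ℝ W]

/-- A function differentiable at a point with an affine support there has the slope of that
support as its gradient. -/
theorem hasGradientAt_of_forall_le {F : W → ℝ} {y ξ : W} (hd : DifferentiableAt ℝ F y)
    (h : ∀ z, F y + ⟪ξ, z - y⟫_ℝ ≤ F z) : HasGradientAt F ξ y := by
  have hFd := hd.hasFDerivAt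
  have hmin : IsLocalMin (fun z => F z - (innerSL ℝ ξ) z) y :=
    Eventually.of_forall fun z => by
      have := h z
      rw [inner_sub_right] at this
      simp only [innerSL_apply_apply]
      linarith
  have h0 := hmin.hasFDerivAt_eq_zero (hFd.sub (innerSL ℝ ξ).hasFDerivAt)
  rw [hasGradientAt_iff_hasFDerivAt]
  rw [sub_eq_zero.1 h0] at hFd
  exact hFd

/-- Differentiability of a supremum of affine functions at the limits of points where the nearly
active slopes are close to each other. -/
theorem differentiableAt_supAffine
    (hmax : ∀ i j, a j + ⟪g j, x i⟫_ℝ ≤ a (σ i) + ⟪g (σ i), x i⟫_ℝ)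
    (hex : ∀ R : ℝ, ∃ M : ℝ, ∀ j, M ≤ ‖g j‖ → a j ≤ -R * ‖g j‖)
    (hcw : ∀ R ε : ℝ, 0 < ε → ∃ δ > 0, ∀ i j, ‖x i‖ ≤ R → ‖g j‖ ≤ R →
      a (σ i) + ⟪g (σ i), x i⟫_ℝ - (a j + ⟪g j, x i⟫_ℝ) ≤ δ → ‖g (σ i) - g j‖ ≤ ε)
    {c : W} (hc : c ∈ closure (range x)) : DifferentiableAt ℝ (supAffine a g) c := by
  obtain ⟨u, hu, hulim⟩ := mem_closure_iff_seq_limit.1 hc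
  choose i hi using hu
  obtain rfl : u = fun k => x (i k) := funext fun k => (hi k).symm
  have : Nonempty J := ⟨σ (i 0)⟩
  have hb := bddAbove_affine hex (hmax (i 0))
  set m := supAffine a g with hmdef
  have hle : ∀ j y, a j + ⟪g j, y⟫_ℝ ≤ m y := fun j y => le_ciSup (hb y) j
  have hmx : ∀ i, m (x i) = a (σ i) + ⟪g (σ i), x i⟫_ℝ := supAffine_eq hmax
  have hmc : Continuous m := (convexOn_supAffine hb).locallyLipschitz.continuous
  have hmlim : Tendsto (fun k => m (x (i k))) atTop (𝓝 (m c)) := (hmc.tendsto c).comp hulim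
  obtain ⟨M, hM0, hM⟩ := exists_affine_le_of_large_slope hex (‖c‖ + 1) (m c - 1)
  have hnear : ∀ᶠ k in atTop, ‖x (i k)‖ ≤ ‖c‖ + 1 :=
    (hulim.norm.eventually (eventually_lt_nhds (lt_add_one ‖c‖))).mono fun _ h => h.le
  have hgb : ∀ᶠ k in atTop, g (σ (i k)) ∈ Metric.closedBall (0 : W) M := by
    filter_upwards [hnear, hmlim.eventually (eventually_gt_nhds (sub_one_lt (m c)))] with k h1 h2
    rw [mem_closedBall_zero_iff]
    by_contra h
    have := hM _ (not_le.1 h).le _ h1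
    rw [← hmx] at this
    linarith
  obtain ⟨ξ, -, φ, hφ, hξ⟩ :=
    tendsto_subseq_of_frequently_bounded Metric.isBounded_closedBall hgb.frequently
  have hφt := hφ.tendsto_atTop
  have hxlim : Tendsto (fun k => x (i (φ k))) atTop (𝓝 c) := hulim.comp hφt
  have hmlim' : Tendsto (fun k => m (x (i (φ k)))) atTop (𝓝 (m c)) := hmlim.comp hφt
  have hξ : Tendsto (fun k => g (σ (i (φ k)))) atTop (𝓝 ξ) := hξ
  -- A function nearly active at `c` is nearly active at `x (i (φ k))` for large `k`, where `hcw`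
  -- puts its slope close to the one converging to `ξ`.
  have hactive : ∀ ε > 0, ∃ δ > 0, ∀ j, m c - δ ≤ a j + ⟪g j, c⟫_ℝ → ‖g j - ξ‖ ≤ ε := by
    intro ε hε
    obtain ⟨δ, hδ, h⟩ := hcw (max (‖c‖ + 1) M) ε hε
    refine ⟨min (δ / 2) (1 / 2), by positivity, fun j hj => ?_⟩
    have hj1 : m c - δ / 2 ≤ a j + ⟪g j, c⟫_ℝ := by
      linarith [min_le_left (δ / 2) (1 / 2 : ℝ)]
    have hj2 : m c - 1 / 2 ≤ a j + ⟪g j, c⟫_ℝ := by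
      linarith [min_le_right (δ / 2) (1 / 2 : ℝ)]
    have hgj : ‖g j‖ ≤ M := by
      by_contra h'
      have := hM j (not_le.1 h').le c (by linarith)
      linarith
    have hlim : Tendsto (fun k => m (x (i (φ k))) - (a j + ⟪g j, x (i (φ k))⟫_ℝ)) atTop
        (𝓝 (m c - (a j + ⟪g j, c⟫_ℝ))) :=
      hmlim'.sub ((tendsto_const_nhds.inner hxlim).const_add (a j))
    have hev : ∀ᶠ k in atTop, ‖g (σ (i (φ k))) - g j‖ ≤ ε := by
      filter_upwards [hφt.eventually hnear,
        hlim.eventually (eventually_lt_nhds (show _ < δ by linarith))] with k h1 h2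
      refine h _ j (h1.trans (le_max_left _ _)) (hgj.trans (le_max_right _ _)) ?_
      rw [← hmx]
      exact h2.le
    rw [norm_sub_rev]
    exact le_of_tendsto (hξ.sub_const (g j)).norm hev
  have hlow : ∀ h, m c + ⟪ξ, h⟫_ℝ ≤ m (c + h) := by
    intro h
    have hlim : Tendsto (fun k => m (x (i (φ k))) +
        ⟪g (σ (i (φ k))), c + h - x (i (φ k))⟫_ℝ) atTop (𝓝 (m c + ⟪ξ, c + h - c⟫_ℝ)) :=
      hmlim'.add (hξ.inner (hxlim.const_sub (c + h)))
    rw [add_sub_cancel_left] at hlim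
    refine le_of_tendsto' hlim fun k => ?_
    rw [hmx, inner_sub_right]
    linarith [hle (σ (i (φ k))) (c + h)]
  suffices HasGradientAt m ξ c from this.differentiableAt
  rw [hasGradientAt_iff_isLittleO_nhds_zero, Asymptotics.isLittleO_iff]
  intro ε hε
  obtain ⟨δ, hδ, hact⟩ := hactive ε hε
  obtain ⟨M', hM0', hM'⟩ := exists_affine_le_of_large_slope hex (‖c‖ + 1) (m c - ‖ξ‖)
  -- Nearly active functions have slope near `ξ`. Inactive ones are either too steep to matter, or
  -- have slope at most `M'` and cannot make up the deficit `δ` within this radius.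
  have hr : 0 < min 1 (δ / (M' + ‖ξ‖ + 1)) := by positivity
  filter_upwards [Metric.ball_mem_nhds (0 : W) hr] with h hh
  rw [mem_ball_zero_iff, lt_min_iff, lt_div_iff₀ (by positivity)] at hh
  have hξh := neg_le_of_abs_le (abs_real_inner_le_norm ξ h)
  have hξh1 : ‖ξ‖ * ‖h‖ ≤ ‖ξ‖ * 1 := by gcongr; exact hh.1.le
  have hεh : 0 ≤ ε * ‖h‖ := by positivity
  rw [Real.norm_of_nonneg (by linarith [hlow h])]
  suffices m (c + h) ≤ m c + ⟪ξ, h⟫_ℝ + ε * ‖h‖ by linarith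
  refine ciSup_le fun j => ?_
  by_cases hj : m c - δ ≤ a j + ⟪g j, c⟫_ℝ
  · have h1 := real_inner_le_norm (g j - ξ) h
    have h2 : ‖g j - ξ‖ * ‖h‖ ≤ ε * ‖h‖ := by gcongr; exact hact j hj
    rw [inner_sub_left] at h1
    rw [inner_add_right]
    linarith [hle j c]
  · rcases le_total M' ‖g j‖ with hg | hg
    · have := hM' j hg (c + h) ((norm_add_le _ _).trans (by linarith))
      linarith
    · have h1 := real_inner_le_norm (g j) h
      have h2 : ‖g j‖ * ‖h‖ ≤ M' * ‖h‖ := by gcongr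
      have h3 := norm_nonneg h
      rw [inner_add_right]
      linarith [hh.2]

/-- If the differences of the slopes span the space, then the supremum of the affine functions is
coercive up to a linear function. -/
theorem exists_coercive_affine [Nonempty J]
    (hspan : Submodule.span ℝ {v | ∃ j j', v = g j - g j'} = ⊤) (a : J → ℝ) :
    ∃ (l : W) (c b : ℝ), 0 < c ∧ ∀ y, ∃ j, ⟪l, y⟫_ℝ + (c * ‖y‖ + b) ≤ a j + ⟪g j, y⟫_ℝ := by
  classical
  obtain ⟨D, hD, -, hDspan, -⟩ :=
    Submodule.exists_finset_span_eq_linearIndepOn ℝ {v | ∃ j j', v = g j - g j'}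
  rw [hspan] at hDspan
  have hD' : ∀ v ∈ D, ∃ j j', v = g j - g j' := fun v hv => hD hv
  choose! p q hpq using hD'
  let j₀ : J := Classical.arbitrary J
  let s : Finset J := insert j₀ (D.image p ∪ D.image q)
  have hs : s.Nonempty := ⟨j₀, Finset.mem_insert_self _ _⟩
  have hcard : (0 : ℝ) < s.card := by exact_mod_cast hs.card_pos
  -- Slopes recentred at their barycentre sum to zero: if none is positive in a direction `u`, all
  -- are orthogonal to `u`, and spanning forces `u = 0`.
  let l : W := (s.card : ℝ)⁻¹ • ∑ j ∈ s, g j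
  have hl : ∑ j ∈ s, (g j - l) = 0 := by
    rw [Finset.sum_sub_distrib, Finset.sum_const, ← Nat.cast_smul_eq_nsmul ℝ,
      smul_inv_smul₀ hcard.ne', sub_self]
  have hpos : ∀ u ∈ Metric.sphere (0 : W) 1, 0 < s.sup' hs fun j => ⟪g j - l, u⟫_ℝ := by
    intro u hu
    by_contra! hcon
    have hnp : ∀ j ∈ s, ⟪g j - l, u⟫_ℝ ≤ 0 := fun j hj =>
      (Finset.le_sup' (fun j => ⟪g j - l, u⟫_ℝ) hj).trans hcon
    have hz : ∑ j ∈ s, ⟪g j - l, u⟫_ℝ = 0 := by rw [← sum_inner, hl, inner_zero_left]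
    rw [Finset.sum_eq_zero_iff_of_nonpos hnp] at hz
    have hperp : ∀ v ∈ Submodule.span ℝ (D : Set W), ⟪v, u⟫_ℝ = 0 := by
      intro v hv
      induction hv using Submodule.span_induction with
      | mem v hv =>
        have h1 := hz (p v) (by simp only [s, Finset.mem_insert, Finset.mem_union]
                                exact Or.inr (Or.inl (Finset.mem_image_of_mem p hv)))
        have h2 := hz (q v) (by simp only [s, Finset.mem_insert, Finset.mem_union]
                                exact Or.inr (Or.inr (Finset.mem_image_of_mem q hv)))
        rw [inner_sub_left] at h1 h2
        rw [hpq v hv, inner_sub_left]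
        linarith
      | zero => exact inner_zero_left _
      | add v w _ _ hv hw => rw [inner_add_left, hv, hw, add_zero]
      | smul r v _ hv => rw [inner_smul_left, hv, mul_zero]
    have hu0 : u = 0 := inner_self_eq_zero.1 (hperp u (by rw [hDspan]; trivial))
    rw [hu0] at hu
    simp at hu
  have hcont : Continuous fun u : W => s.sup' hs fun j => ⟪g j - l, u⟫_ℝ :=
    Continuous.finset_sup'_apply hs fun j _ => continuous_const.inner continuous_id
  obtain ⟨c, hc, hmin⟩ :=
    (isCompact_sphere (0 : W) 1).exists_forall_le' hcont.continuousOn hpos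
  refine ⟨l, c, s.inf' hs a, hc, fun y => ?_⟩
  rcases eq_or_ne y 0 with rfl | hy
  · have h0 : s.inf' hs a ≤ a j₀ := Finset.inf'_le a (Finset.mem_insert_self _ _)
    exact ⟨j₀, by simp only [inner_zero_right, norm_zero]; linarith⟩
  · have hy' : 0 < ‖y‖ := norm_pos_iff.2 hy
    have h1 := hmin (‖y‖⁻¹ • y) (by simp [norm_smul, hy'.ne'])
    obtain ⟨j, hj, hj'⟩ := (Finset.le_sup'_iff hs).1 h1
    refine ⟨j, ?_⟩
    rw [inner_smul_right, inner_sub_left, ← div_eq_inv_mul, le_div_iff₀ hy'] at hj'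
    linarith [Finset.inf'_le a hj]

/-- Extension of convex jets under a spanning condition on the slopes. -/
theorem exists_convex_contDiff_of_span_eq_top [Nonempty I]
    (hmax : ∀ i j, a j + ⟪g j, x i⟫_ℝ ≤ a (σ i) + ⟪g (σ i), x i⟫_ℝ)
    (hex : ∀ R : ℝ, ∃ M : ℝ, ∀ j, M ≤ ‖g j‖ → a j ≤ -R * ‖g j‖)
    (hcw : ∀ R ε : ℝ, 0 < ε → ∃ δ > 0, ∀ i j, ‖x i‖ ≤ R → ‖g j‖ ≤ R →
      a (σ i) + ⟪g (σ i), x i⟫_ℝ - (a j + ⟪g j, x i⟫_ℝ) ≤ δ → ‖g (σ i) - g j‖ ≤ ε)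
    (hspan : Submodule.span ℝ {v | ∃ j j', v = g j - g j'} = ⊤) :
    ∃ F : W → ℝ, ConvexOn ℝ univ F ∧ ContDiff ℝ 1 F ∧
      ∀ i, F (x i) = a (σ i) + ⟪g (σ i), x i⟫_ℝ ∧ HasGradientAt F (g (σ i)) (x i) := by
  let i₀ : I := Classical.arbitrary I
  have : Nonempty J := ⟨σ i₀⟩
  have hb := bddAbove_affine hex (hmax i₀)
  have hconv := convexOn_supAffine hb
  have hmx := supAffine_eq hmax
  set m := supAffine a g with hmdef
  have hle : ∀ j y, a j + ⟪g j, y⟫_ℝ ≤ m y := fun j y => le_ciSup (hb y) j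
  obtain ⟨G, hGd, hmG, hGC⟩ := exists_differentiable_ge_eqOn hconv.locallyLipschitz.continuous
    isClosed_closure (range_nonempty x).closure
    fun c hc => differentiableAt_supAffine hmax hex hcw hc
  obtain ⟨l, c, b, hc, hcoer⟩ := exists_coercive_affine hspan a
  have hlin : ConvexOn ℝ univ fun y : W => ⟪l, y⟫_ℝ := ((innerₛₗ ℝ) l).convexOn convex_univ
  have hlin' : ConvexOn ℝ univ fun y : W => -⟪l, y⟫_ℝ :=
    (((innerₛₗ ℝ) l).concaveOn convex_univ).neg
  have hHd : Differentiable ℝ fun y => G y - ⟪l, y⟫_ℝ :=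
    hGd.sub ((innerSL ℝ l).differentiable)
  have hH : ∀ y, c * ‖y‖ + b ≤ G y - ⟪l, y⟫_ℝ := fun y => by
    obtain ⟨j, hj⟩ := hcoer y
    linarith [hle j y, hmG y]
  have hHb : ∀ y, b ≤ G y - ⟪l, y⟫_ℝ := fun y => by
    have : 0 ≤ c * ‖y‖ := by positivity
    linarith [hH y]
  set F : W → ℝ := fun y => convexEnvelope (fun y => G y - ⟪l, y⟫_ℝ) y + ⟪l, y⟫_ℝ with hF
  have hFC : ContDiff ℝ 1 F :=
    (contDiff_convexEnvelope hHd hc hH).add (innerSL ℝ l).contDiff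
  have hmF : ∀ y, m y ≤ F y := fun y => by
    have := le_convexEnvelope (m := fun y => m y + -⟪l, y⟫_ℝ) (g := fun y => G y - ⟪l, y⟫_ℝ)
      (hconv.add hlin') (fun y => by linarith [hmG y]) y
    simp only [hF]
    linarith
  have hFG : ∀ y, F y ≤ G y := fun y => by
    have := convexEnvelope_le hHb y
    simp only [hF]
    linarith
  refine ⟨F, (convexOn_convexEnvelope hHb).add hlin, hFC, fun i => ?_⟩
  have heq : F (x i) = a (σ i) + ⟪g (σ i), x i⟫_ℝ := by
    refine le_antisymm ?_ ((hle _ _).trans (hmF _))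
    rw [← hmx, ← hGC _ (subset_closure ⟨i, rfl⟩)]
    exact hFG _
  refine ⟨heq, ?_⟩
  refine hasGradientAt_of_forall_le (hFC.differentiable one_ne_zero (x i)) fun y => ?_
  rw [heq, inner_sub_right]
  linarith [(hle (σ i) y).trans (hmF y)]

end Affine

/-! ### Gradients of `C¹` convex functions. -/

section Necessity

variable {W : Type*} [NormedAddCommGroup W] [InnerProductSpace ℝ W] [FiniteDimensional ℝ W]

theorem add_inner_gradient_le {F : W → ℝ} (hF : ConvexOn ℝ univ F) (hd : Differentiable ℝ F)
    (x y : W) : F x + ⟪gradient F x, y - x⟫_ℝ ≤ F y := by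
  rw [inner_gradient_left]
  exact add_fderiv_le_of_convexOn hF (hd x) y

theorem continuous_gradient {F : W → ℝ} (hF : ContDiff ℝ 1 F) : Continuous (gradient F) :=
  (InnerProductSpace.toDual ℝ W).symm.continuous.comp (hF.continuous_fderiv one_ne_zero)

/-- A convex function whose gradients lie in `v + X` is affine with slope `v` along `Xᗮ`. -/
theorem apply_add_of_gradient_sub_mem {F : W → ℝ} (hF : ConvexOn ℝ univ F)
    (hd : Differentiable ℝ F) {X : Submodule ℝ W} {v : W} (hX : ∀ x, gradient F x - v ∈ X)
    (x : W) {h : W} (hh : h ∈ Xᗮ) : F (x + h) = F x + ⟪v, h⟫_ℝ := by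
  have hin : ∀ y, ⟪gradient F y, h⟫_ℝ = ⟪v, h⟫_ℝ := fun y => by
    have := (Submodule.mem_orthogonal X h).1 hh _ (hX y)
    rw [inner_sub_left] at this
    linarith
  have h1 := add_inner_gradient_le hF hd x (x + h)
  have h2 := add_inner_gradient_le hF hd (x + h) x
  rw [add_sub_cancel_left, hin] at h1
  rw [sub_add_cancel_left, inner_neg_right, hin] at h2
  linarith

theorem gradient_add_of_gradient_sub_mem {F : W → ℝ} (hF : ConvexOn ℝ univ F)
    (hd : Differentiable ℝ F) {X : Submodule ℝ W} {v : W} (hX : ∀ x, gradient F x - v ∈ X)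
    (x : W) {h : W} (hh : h ∈ Xᗮ) : gradient F (x + h) = gradient F x := by
  refine (hasGradientAt_of_forall_le (hd _) fun z => ?_).gradient
  have h1 := add_inner_gradient_le hF hd x (z - h)
  have h2 := apply_add_of_gradient_sub_mem hF hd hX x hh
  have h3 := apply_add_of_gradient_sub_mem hF hd hX (z - h) hh
  rw [sub_add_cancel] at h3
  rw [show z - (x + h) = z - h - x by abel]
  linarith

/-- Invariance along `Xᗮ` replaces `x k` by its bounded projection. Along a subsequence the
projections and the gradients at `z k` converge; the vanishing gap makes the limit slope a
subgradient at the limit point, hence the gradient there. The points `z k` themselves may be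
unbounded. -/
theorem tendsto_gradient_sub {F : W → ℝ} (hF : ConvexOn ℝ univ F) (hC : ContDiff ℝ 1 F)
    {X : Submodule ℝ W} {v : W} (hX : ∀ x, gradient F x - v ∈ X) {x z : ℕ → W}
    (hx : Bornology.IsBounded (range fun k => X.starProjection (x k)))
    (hz : Bornology.IsBounded (range fun k => gradient F (z k)))
    (hlim : Tendsto (fun k => F (x k) - F (z k) - ⟪gradient F (z k), x k - z k⟫_ℝ) atTop (𝓝 0)) :
    Tendsto (fun k => ‖gradient F (x k) - gradient F (z k)‖) atTop (𝓝 0) := by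
  have hd : Differentiable ℝ F := hC.differentiable one_ne_zero
  have horth : ∀ k, x k - X.starProjection (x k) ∈ Xᗮ := fun k =>
    X.sub_starProjection_mem_orthogonal (x k)
  set y : ℕ → W := fun k => X.starProjection (x k) with hy
  have hxy : ∀ k, x k = y k + (x k - y k) := fun k => by abel
  have hgrad : ∀ k, gradient F (x k) = gradient F (y k) := fun k => by
    rw [hxy k]; exact gradient_add_of_gradient_sub_mem hF hd hX _ (horth k)
  have hval : ∀ k, F (x k) - F (z k) - ⟪gradient F (z k), x k - z k⟫_ℝ =
      F (y k) - F (z k) - ⟪gradient F (z k), y k - z k⟫_ℝ := fun k => by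
    have h1 := apply_add_of_gradient_sub_mem hF hd hX (y k) (horth k)
    rw [← hxy k] at h1
    have h2 := (Submodule.mem_orthogonal X _).1 (horth k) _ (hX (z k))
    change ⟪gradient F (z k) - v, x k - y k⟫_ℝ = 0 at h2
    rw [inner_sub_left] at h2
    have h3 : ⟪gradient F (z k), x k - z k⟫_ℝ =
        ⟪gradient F (z k), y k - z k⟫_ℝ + ⟪gradient F (z k), x k - y k⟫_ℝ := by
      rw [← inner_add_right]; congr 1; abel
    change F (x k) = F (y k) + ⟪v, x k - y k⟫_ℝ at h1
    linarith
  simp only [hval] at hlim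
  simp only [hgrad]
  refine tendsto_of_subseq_tendsto fun ns hns => ?_
  obtain ⟨⟨y₀, ξ⟩, -, φ, hφ, hl⟩ := tendsto_subseq_of_bounded (hx.prod hz)
    (x := fun k => (y (ns k), gradient F (z (ns k)))) fun k => ⟨⟨ns k, rfl⟩, ⟨ns k, rfl⟩⟩
  have hl1 : Tendsto (fun k => y (ns (φ k))) atTop (𝓝 y₀) := (continuous_fst.tendsto _).comp hl
  have hl2 : Tendsto (fun k => gradient F (z (ns (φ k)))) atTop (𝓝 ξ) :=
    (continuous_snd.tendsto _).comp hl
  have hl3 := (hlim.comp hns).comp hφ.tendsto_atTop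
  have hξ : gradient F y₀ = ξ := by
    refine (hasGradientAt_of_forall_le (hd _) fun u => ?_).gradient
    have hl4 := (((hC.continuous.tendsto y₀).comp hl1).sub hl3).add (hl2.inner (hl1.const_sub u))
    rw [sub_zero] at hl4
    refine le_of_tendsto' hl4 fun k => ?_
    have := add_inner_gradient_le hF hd (z (ns (φ k))) u
    simp only [Function.comp_apply, inner_sub_right] at this ⊢
    linarith
  refine ⟨φ, ?_⟩
  have := ((((continuous_gradient hC).tendsto y₀).comp hl1).sub hl2).norm
  rwa [hξ, sub_self, norm_zero] at this

theorem exists_pos_le_of_forall_not_tendsto {S : Type*} {φ : S → ℝ} (h0 : ∀ s, 0 ≤ φ s)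
    (hseq : ∀ s : ℕ → S, ¬ Tendsto (fun k => φ (s k)) atTop (𝓝 0)) : ∃ ε > 0, ∀ s, ε ≤ φ s := by
  by_contra! hcon
  choose s hs using fun k : ℕ => hcon (1 / ((k : ℝ) + 1)) (by positivity)
  exact hseq s (squeeze_zero (fun k => h0 _) (fun k => (hs k).le)
    tendsto_one_div_add_atTop_nhds_zero_nat)

/-- The conjugate of a continuous function has superlinear growth along gradients. -/
theorem tendsto_inner_gradient_sub_div {F : W → ℝ} (hF : ConvexOn ℝ univ F)
    (hC : ContDiff ℝ 1 F) {x : ℕ → W} (hx : Tendsto (fun k => ‖gradient F (x k)‖) atTop atTop) :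
    Tendsto (fun k => (⟪gradient F (x k), x k⟫_ℝ - F (x k)) / ‖gradient F (x k)‖) atTop atTop := by
  have hd : Differentiable ℝ F := hC.differentiable one_ne_zero
  rw [tendsto_atTop]
  intro R
  have : ProperSpace W := FiniteDimensional.proper ℝ W
  obtain ⟨B, hB⟩ := (isCompact_closedBall (0 : W) |R + 1|).bddAbove_image
    hC.continuous.continuousOn
  -- Testing the support at `x k` on the vector of length `|R + 1|` along `ξ` gives `(R + 1) * ‖ξ‖ -
  -- B`, and `B ≤ ‖ξ‖` absorbs the error.
  filter_upwards [hx.eventually_ge_atTop (max 1 B)] with k hk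
  have h1 : 1 ≤ ‖gradient F (x k)‖ := (le_max_left _ _).trans hk
  have h2 : B ≤ ‖gradient F (x k)‖ := (le_max_right _ _).trans hk
  have hpos : 0 < ‖gradient F (x k)‖ := by linarith
  rw [le_div_iff₀ hpos]
  set ξ := gradient F (x k)
  have h3 := add_inner_gradient_le hF hd (x k) (((R + 1) / ‖ξ‖) • ξ)
  have h4 : F (((R + 1) / ‖ξ‖) • ξ) ≤ B := hB ⟨_, by
    rw [mem_closedBall_zero_iff, norm_smul, norm_div, norm_norm, div_mul_cancel₀ _ hpos.ne',
      Real.norm_eq_abs], rfl⟩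
  rw [inner_sub_right, inner_smul_right, real_inner_self_eq_norm_sq] at h3
  have h5 : (R + 1) / ‖ξ‖ * ‖ξ‖ ^ 2 = (R + 1) * ‖ξ‖ := by field_simp
  linarith

/-- A set whose span contains `Y` contains a family which is a basis modulo `Y`. -/
theorem exists_fin_basis_mod {A : Set W} {Y : Submodule ℝ W} (hY : Y ≤ Submodule.span ℝ A) :
    ∃ u : Fin (Module.finrank ℝ (Submodule.span ℝ A) - Module.finrank ℝ Y) → W,
      (∀ j, u j ∈ A) ∧ Submodule.span ℝ A ≤ Y ⊔ Submodule.span ℝ (range u) ∧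
      (∀ j, u j ∉ Y) ∧ Function.Injective u := by
  obtain ⟨f, hfA, hfspan, hfind⟩ :=
    Submodule.exists_fun_fin_finrank_span_eq ℝ (Y.mkQ '' A)
  have hrank : Module.finrank ℝ (Submodule.span ℝ A) - Module.finrank ℝ Y =
      Module.finrank ℝ (Submodule.span ℝ (Y.mkQ '' A)) := by
    have h1 := LinearMap.finrank_range_add_finrank_ker (Y.mkQ.domRestrict (Submodule.span ℝ A))
    rw [LinearMap.range_domRestrict, Submodule.map_span, LinearMap.ker_domRestrict,
      Submodule.ker_mkQ] at h1
    have h2 := (Submodule.comapSubtypeEquivOfLe hY).finrank_eq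
    omega
  choose u huA huf using hfA
  refine ⟨fun j => u (Fin.cast hrank j), fun j => huA _, ?_, fun j hj => ?_, fun i j hij => ?_⟩
  · have hr : range (fun j => u (Fin.cast hrank j)) = range u :=
      (finCongr hrank).surjective.range_comp u
    rw [hr, ← Submodule.comap_map_mkQ, ← Submodule.map_le_iff_le_comap, Submodule.map_span,
      Submodule.map_span]
    refine hfspan.ge.trans (Submodule.span_mono ?_)
    rintro _ ⟨j, rfl⟩
    exact ⟨u j, ⟨j, rfl⟩, huf j⟩
  · refine hfind.ne_zero (Fin.cast hrank j) ?_
    rw [← huf]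
    simpa using hj
  · have : f (Fin.cast hrank i) = f (Fin.cast hrank j) := by
      rw [← huf, ← huf]; exact congrArg _ hij
    exact Fin.cast_injective _ (hfind.injective this)

end Necessity

/-! ### Jets on `E`: necessity of the conditions. -/

section Jets

variable {n : ℕ} {E : Set (EuclideanSpace ℝ (Fin n))}

theorem sub_mem_diffSpan {S : Set (EuclideanSpace ℝ (Fin n))} {u v : EuclideanSpace ℝ (Fin n)}
    (hu : u ∈ S) (hv : v ∈ S) : u - v ∈ diffSpan S :=
  Submodule.subset_span ⟨u, hu, v, hv, rfl⟩

theorem diffSpan_le {S : Set (EuclideanSpace ℝ (Fin n))} {v : EuclideanSpace ℝ (Fin n)}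
    {X : Submodule ℝ (EuclideanSpace ℝ (Fin n))} (h : ∀ u ∈ S, u - v ∈ X) : diffSpan S ≤ X := by
  refine Submodule.span_le.2 ?_
  rintro _ ⟨u, hu, w, hw, rfl⟩
  rw [← sub_sub_sub_cancel_right u w v]
  exact X.sub_mem (h u hu) (h w hw)

/-- Conditions (a)-(d) hold for the jets of a `C¹` convex function at points whose gradients are
independent modulo the span of the differences of the gradients on `E`. -/
theorem addedJets_of_convexOn {F : EuclideanSpace ℝ (Fin n) → ℝ} (hF : ConvexOn ℝ univ F)
    (hC : ContDiff ℝ 1 F) (e₀ : E) {X : Submodule ℝ (EuclideanSpace ℝ (Fin n))}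
    (hX : ∀ x, gradient F x - gradient F e₀ ∈ X) {m : ℕ} (hm : 0 < m)
    {p : Fin m → EuclideanSpace ℝ (Fin n)}
    (hspan : X ≤ diffSpan (range fun e : E => gradient F e) ⊔
      Submodule.span ℝ (range fun j => gradient F (p j) - gradient F e₀))
    (hp : ∀ j, gradient F (p j) - gradient F e₀ ∉ diffSpan (range fun e : E => gradient F e))
    (hinj : Function.Injective fun j => gradient F (p j) - gradient F e₀) :
    AddedJets (fun e : E => F e) (fun e : E => gradient F e) X p (fun j => F (p j))
      (fun j => gradient F (p j)) := by
  have hd : Differentiable ℝ F := hC.differentiable one_ne_zero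
  set Y := diffSpan (range fun e : E => gradient F e) with hY
  have hYmem : ∀ e : E, gradient F e - gradient F e₀ ∈ Y := fun e =>
    sub_mem_diffSpan ⟨e, rfl⟩ ⟨e₀, rfl⟩
  have hYc : IsClosed (Y : Set (EuclideanSpace ℝ (Fin n))) := Y.closed_of_finiteDimensional
  -- Against `hp`, this excludes `p j ∈ closure E` and the vanishing of the gaps in (c) and (d).
  have hlimit : ∀ (y : EuclideanSpace ℝ (Fin n)) (z : ℕ → E),
      Tendsto (fun k => gradient F (z k)) atTop (𝓝 y) → y - gradient F e₀ ∈ Y := fun y z hz =>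
    hYc.mem_of_tendsto (hz.sub_const _) (Eventually.of_forall fun k => hYmem (z k))
  have : Nonempty (Fin m) := ⟨⟨0, hm⟩⟩
  refine ⟨fun j hj => hp j ?_, ?_, fun j i hij => ?_, fun j N => ?_, fun N => ?_⟩
  · obtain ⟨u, hu, hlim⟩ := mem_closure_iff_seq_limit.1 hj
    exact hlimit _ (fun k => ⟨u k, hu k⟩) (((continuous_gradient hC).tendsto _).comp hlim)
  · refine le_antisymm (hspan.trans (sup_le ?_ ?_)) (diffSpan_le (v := gradient F e₀) ?_)
    · refine diffSpan_le (v := gradient F e₀) fun u hu =>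
        sub_mem_diffSpan (Or.inl hu) (Or.inl ⟨e₀, rfl⟩)
    · refine Submodule.span_le.2 ?_
      rintro _ ⟨j, rfl⟩
      exact sub_mem_diffSpan (Or.inr ⟨j, rfl⟩) (Or.inl ⟨e₀, rfl⟩)
    · rintro _ (⟨e, rfl⟩ | ⟨j, rfl⟩)
      · exact hX _
      · exact hX _
  · refine (add_inner_gradient_le hF hd (p i) (p j)).lt_of_ne fun heq => hij (hinj ?_)
    have : gradient F (p j) = gradient F (p i) := by
      refine (hasGradientAt_of_forall_le (hd _) fun z => ?_).gradient
      have := add_inner_gradient_le hF hd (p i) z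
      rw [← heq]
      simp only [inner_sub_right] at this ⊢
      linarith
    simp only [this]
  · have hgap : ∃ ε > 0, ∀ z : {z : E // ‖gradient F (z : EuclideanSpace ℝ (Fin n))‖ ≤ N},
        ε ≤ F (p j) - F z.1 - ⟪gradient F z.1, p j - z.1⟫_ℝ := by
      refine exists_pos_le_of_forall_not_tendsto
        (fun z => by linarith [add_inner_gradient_le hF hd z.1 (p j)])
        (fun z hz => hp j (hlimit _ (fun k => (z k).1) ?_))
      have h := tendsto_gradient_sub hF hC hX (x := fun _ => p j) (z := fun k => (z k).1.1)
        (by simp) ((Metric.isBounded_closedBall (x := 0) (r := (N : ℝ))).subset (by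
          rintro _ ⟨k, rfl⟩; simpa using (z k).2)) hz
      rw [tendsto_iff_norm_sub_tendsto_zero]
      simpa only [norm_sub_rev] using h
    obtain ⟨ε, hε, hle⟩ := hgap
    refine lt_of_le_of_lt (iSup_le fun z => ?_)
      (EReal.coe_lt_coe_iff.2 (show F (p j) - ε < F (p j) by linarith))
    exact EReal.coe_le_coe_iff.2 (by linarith [hle z])
  · have hj : ∀ j, ∃ ε > 0,
        ∀ x : {x : E // ‖X.starProjection (x : EuclideanSpace ℝ (Fin n))‖ ≤ N},
          ε ≤ F x.1 - F (p j) - ⟪gradient F (p j), x.1 - p j⟫_ℝ := by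
      intro j
      refine exists_pos_le_of_forall_not_tendsto
        (fun x => by linarith [add_inner_gradient_le hF hd (p j) x.1])
        (fun x hx => hp j (hlimit _ (fun k => (x k).1) ?_))
      have h := tendsto_gradient_sub hF hC hX (x := fun k => (x k).1.1) (z := fun _ => p j)
        ((Metric.isBounded_closedBall (x := 0) (r := (N : ℝ))).subset (by
          rintro _ ⟨k, rfl⟩; simpa using (x k).2)) (by simp) hx
      rwa [tendsto_iff_norm_sub_tendsto_zero]
    choose ε hε hle using hj
    obtain ⟨j₀, hj₀⟩ := Finite.exists_min ε
    refine lt_of_lt_of_le (EReal.coe_pos.2 (hε j₀)) (le_iInf fun x => EReal.coe_le_coe_iff.2 ?_)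
    rw [le_sub_comm]
    refine ciSup_le fun j => ?_
    linarith [hle j x, hj₀ j]

theorem exists_admissibleSubspace_of_convexOn {F : EuclideanSpace ℝ (Fin n) → ℝ}
    (hF : ConvexOn ℝ univ F) (hC : ContDiff ℝ 1 F) :
    ∃ X : Submodule ℝ (EuclideanSpace ℝ (Fin n)),
      AdmissibleSubspace (fun e : E => F e) (fun e : E => gradient F e) X ∧
        SequentialCW1 (fun e : E => F e) (fun e : E => gradient F e) X := by
  rcases isEmpty_or_nonempty E with hE | ⟨⟨e₀⟩⟩
  · exact ⟨_, ⟨le_rfl, Or.inl rfl⟩, fun x => isEmptyElim (x 0)⟩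
  set A : Set (EuclideanSpace ℝ (Fin n)) := range fun x => gradient F x - gradient F e₀ with hA
  have hX : ∀ x, gradient F x - gradient F e₀ ∈ Submodule.span ℝ A := fun x =>
    Submodule.subset_span ⟨x, rfl⟩
  have hY : diffSpan (range fun e : E => gradient F e) ≤ Submodule.span ℝ A :=
    diffSpan_le (v := gradient F e₀) (by rintro _ ⟨e, rfl⟩; exact hX e)
  refine ⟨Submodule.span ℝ A, ⟨hY, ?_⟩, fun x z hx hz hlim => tendsto_gradient_sub hF hC hX hx hz hlim⟩
  rcases hY.eq_or_lt with heq | hlt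
  · exact Or.inl heq
  · right
    obtain ⟨u, huA, hspan, huY, hinj⟩ := exists_fin_basis_mod hY
    choose p hp using huA
    obtain rfl : (fun j => gradient F (p j) - gradient F e₀) = u := funext hp
    exact ⟨p, _, _, addedJets_of_convexOn hF hC e₀ hX
      (Nat.sub_pos_of_lt (Submodule.finrank_lt_finrank_of_lt hlt)) hspan huY hinj⟩

/-! ### Sufficiency, by reduction to the subspace `X`. -/

theorem inner_starProjection_of_mem {X : Submodule ℝ (EuclideanSpace ℝ (Fin n))}
    {u : EuclideanSpace ℝ (Fin n)} (hu : u ∈ X) (y : EuclideanSpace ℝ (Fin n)) :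
    ⟪u, X.starProjection y⟫_ℝ = ⟪u, y⟫_ℝ := by
  rw [← Submodule.inner_starProjection_left_eq_right, Submodule.starProjection_eq_self_iff.2 hu]

/-- Quantitative form of condition (EX). -/
theorem CondEX.exists_le {f : E → ℝ} {G : E → EuclideanSpace ℝ (Fin n)} (h : CondEX f G) (R : ℝ) :
    ∃ M : ℝ, ∀ e : E, M ≤ ‖G e‖ → f e - ⟪G e, e⟫_ℝ ≤ -R * ‖G e‖ := by
  by_contra! hcon
  choose e he hlt using fun k : ℕ => hcon ((k : ℝ) + 1)
  have hG : Tendsto (fun k => ‖G (e k)‖) atTop atTop :=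
    tendsto_atTop_mono he (tendsto_atTop_add_const_right _ _ tendsto_natCast_atTop_atTop)
  obtain ⟨k, hk⟩ := ((h e hG).eventually_ge_atTop R).exists
  have hpos : 0 < ‖G (e k)‖ := by linarith [he k, Nat.cast_nonneg (α := ℝ) k]
  rw [le_div_iff₀ hpos] at hk
  linarith [hlt k]

/-- Quantitative form of the sequential condition. -/
theorem SequentialCW1.exists_le {f : E → ℝ} {G : E → EuclideanSpace ℝ (Fin n)}
    {X : Submodule ℝ (EuclideanSpace ℝ (Fin n))} (h : SequentialCW1 f G X)
    (hconv : ConvexityIneq f G) (R : ℝ) {ε : ℝ} (hε : 0 < ε) :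
    ∃ δ > 0, ∀ x z : E, ‖X.starProjection (x : EuclideanSpace ℝ (Fin n))‖ ≤ R → ‖G z‖ ≤ R →
      f x - f z - ⟪G z, (x : EuclideanSpace ℝ (Fin n)) - z⟫_ℝ ≤ δ → ‖G x - G z‖ ≤ ε := by
  by_contra! hcon
  choose x z hx hz hle hlt using fun k : ℕ => hcon (1 / ((k : ℝ) + 1)) (by positivity)
  have hlim := h x z
    ((Metric.isBounded_closedBall (x := 0) (r := R)).subset (by
      rintro _ ⟨k, rfl⟩; simpa using hx k))
    ((Metric.isBounded_closedBall (x := 0) (r := R)).subset (by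
      rintro _ ⟨k, rfl⟩; simpa using hz k))
    (squeeze_zero (fun k => by linarith [hconv (x k) (z k)]) hle
      tendsto_one_div_add_atTop_nhds_zero_nat)
  obtain ⟨k, hk⟩ := (hlim.eventually (eventually_lt_nhds hε)).exists
  linarith [hlt k]

/-- Sufficiency, for a subspace generated with the help of finitely many affine functions lying
uniformly below the jet. -/
theorem hasConvexC1Extension_of_affine {f : E → ℝ} {G : E → EuclideanSpace ℝ (Fin n)}
    (e₀ : E) (hconv : ConvexityIneq f G) (hex : CondEX f G)
    {X : Submodule ℝ (EuclideanSpace ℝ (Fin n))} (hcw : SequentialCW1 f G X)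
    {κ : Type*} [Finite κ] (b : κ → ℝ) (w : κ → EuclideanSpace ℝ (Fin n))
    (hX : X = diffSpan (range G ∪ range w))
    (hgap : ∀ N : ℕ, ∃ c > 0, ∀ x : E, ‖X.starProjection (x : EuclideanSpace ℝ (Fin n))‖ ≤ N →
      ∀ j, b j + ⟪w j, (x : EuclideanSpace ℝ (Fin n))⟫_ℝ + c ≤ f x) :
    HasConvexC1Extension f G := by
  set v := G e₀ with hv
  have hGX : ∀ e, G e - v ∈ X := fun e => by
    rw [hX]; exact sub_mem_diffSpan (Or.inl ⟨e, rfl⟩) (Or.inl ⟨e₀, rfl⟩)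
  have hwX : ∀ j, w j - v ∈ X := fun j => by
    rw [hX]; exact sub_mem_diffSpan (Or.inr ⟨j, rfl⟩) (Or.inl ⟨e₀, rfl⟩)
  -- Shifting by `v` puts every slope in `X`, so its pairing with `y` depends only on `P y` and the
  -- constant terms stay unchanged.
  let g : E ⊕ κ → X := Sum.elim (fun e => ⟨G e - v, hGX e⟩) fun j => ⟨w j - v, hwX j⟩
  let a : E ⊕ κ → ℝ := Sum.elim (fun e => f e - ⟪G e, (e : EuclideanSpace ℝ (Fin n))⟫_ℝ) b
  let P := X.orthogonalProjectionOnto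
  let x : E → X := fun e => P e
  have hPcoe : ∀ y, ((P y : X) : EuclideanSpace ℝ (Fin n)) = X.starProjection y := fun y => rfl
  have hxn : ∀ e : E, ‖x e‖ = ‖X.starProjection (e : EuclideanSpace ℝ (Fin n))‖ := fun e => rfl
  have hginl : ∀ (e : E) (y : EuclideanSpace ℝ (Fin n)),
      ⟪g (Sum.inl e), P y⟫_ℝ = ⟪G e, y⟫_ℝ - ⟪v, y⟫_ℝ := fun e y => by
    rw [Submodule.coe_inner, hPcoe, inner_starProjection_of_mem (g (Sum.inl e)).2]
    exact inner_sub_left _ _ _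
  have hginr : ∀ (j : κ) (y : EuclideanSpace ℝ (Fin n)),
      ⟪g (Sum.inr j), P y⟫_ℝ = ⟪w j, y⟫_ℝ - ⟪v, y⟫_ℝ := fun j y => by
    rw [Submodule.coe_inner, hPcoe, inner_starProjection_of_mem (g (Sum.inr j)).2]
    exact inner_sub_left _ _ _
  have hself : ∀ e : E, a (Sum.inl e) + ⟪g (Sum.inl e), x e⟫_ℝ =
      f e - ⟪v, (e : EuclideanSpace ℝ (Fin n))⟫_ℝ := fun e => by
    rw [hginl]; simp only [a, Sum.elim_inl]; ring
  have hmax : ∀ (e : E) (j : E ⊕ κ),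
      a j + ⟪g j, x e⟫_ℝ ≤ a (Sum.inl e) + ⟪g (Sum.inl e), x e⟫_ℝ := by
    rintro e (e' | j)
    · rw [hself, hginl]
      have := hconv e e'
      rw [inner_sub_right] at this
      simp only [a, Sum.elim_inl]
      linarith
    · rw [hself, hginr]
      obtain ⟨N, hN⟩ := exists_nat_ge ‖X.starProjection (e : EuclideanSpace ℝ (Fin n))‖
      obtain ⟨c, hc, h⟩ := hgap N
      simp only [a, Sum.elim_inr]
      linarith [h e hN j]
  have hex' : ∀ R : ℝ, ∃ M : ℝ, ∀ j, M ≤ ‖g j‖ → a j ≤ -R * ‖g j‖ := by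
    intro R
    obtain ⟨M, hM⟩ := hex.exists_le (2 * |R|)
    obtain ⟨B, hB⟩ := (finite_range fun j => ‖g (Sum.inr j)‖).bddAbove
    -- The bound `2 * ‖v‖` ensures `‖G e - v‖ ≤ 2 * ‖G e‖`, whence the factor in `2 * |R|`; `B + 1`
    -- excludes the finitely many added slopes.
    refine ⟨max (max (M + ‖v‖) (2 * ‖v‖)) (B + 1), ?_⟩
    rintro (e | j) hj
    · have h1 : M + ‖v‖ ≤ ‖G e - v‖ := (le_max_left _ _).trans ((le_max_left _ _).trans hj)
      have h2 : 2 * ‖v‖ ≤ ‖G e - v‖ := (le_max_right _ _).trans ((le_max_left _ _).trans hj)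
      have h3 := norm_sub_le (G e) v
      have h4 := hM e (by linarith)
      have h5 : |R| * ‖G e - v‖ ≤ |R| * (2 * ‖G e‖) := by gcongr; linarith
      have h6 : R * ‖G e - v‖ ≤ |R| * ‖G e - v‖ := by gcongr; exact le_abs_self R
      change f e - ⟪G e, (e : EuclideanSpace ℝ (Fin n))⟫_ℝ ≤ -R * ‖G e - v‖
      linarith
    · have h1 : B + 1 ≤ ‖g (Sum.inr j)‖ := (le_max_right _ _).trans hj
      have h2 : ‖g (Sum.inr j)‖ ≤ B := hB ⟨j, rfl⟩
      linarith
  have hcw' : ∀ R ε : ℝ, 0 < ε → ∃ δ > 0, ∀ e j, ‖x e‖ ≤ R → ‖g j‖ ≤ R →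
      a (Sum.inl e) + ⟪g (Sum.inl e), x e⟫_ℝ - (a j + ⟪g j, x e⟫_ℝ) ≤ δ →
        ‖g (Sum.inl e) - g j‖ ≤ ε := by
    intro R ε hε
    obtain ⟨δ, hδ, h⟩ := hcw.exists_le hconv (R + ‖v‖) hε
    obtain ⟨N, hN⟩ := exists_nat_ge R
    obtain ⟨c, hc, hgap⟩ := hgap N
    -- A gap of at most `c / 2` cannot come from an added function, which lies at least `c` below;
    -- `δ` handles the jets of `E`.
    refine ⟨min δ (c / 2), by positivity, ?_⟩
    rintro e (z | j) he hj hle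
    · have hle' := hle.trans (min_le_left _ _)
      rw [hself, hginl] at hle'
      have hj : ‖G z - v‖ ≤ R := hj
      have h1 := norm_sub_norm_le (G z) v
      have h2 := h e z (by rw [← hxn]; linarith [norm_nonneg v]) (by linarith) (by
        rw [inner_sub_right]
        simp only [a, Sum.elim_inl] at hle'
        linarith)
      change ‖(G e - v) - (G z - v)‖ ≤ ε
      rwa [sub_sub_sub_cancel_right]
    · have hle' := hle.trans (min_le_right _ _)
      rw [hself, hginr] at hle'
      have := hgap e (by rw [← hxn]; linarith) j
      simp only [a, Sum.elim_inr] at hle'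
      linarith
  have hspan : Submodule.span ℝ {u | ∃ j j', u = g j - g j'} = ⊤ := by
    have hg : ∀ u ∈ range G ∪ range w, ∃ j, (g j : EuclideanSpace ℝ (Fin n)) = u - v := by
      rintro _ (⟨e, rfl⟩ | ⟨j, rfl⟩)
      · exact ⟨Sum.inl e, rfl⟩
      · exact ⟨Sum.inr j, rfl⟩
    refine Submodule.map_injective_of_injective X.injective_subtype ?_
    refine le_antisymm (Submodule.map_mono le_top) ?_
    rw [Submodule.map_subtype_top, Submodule.map_span]
    refine hX.le.trans (Submodule.span_mono ?_)
    rintro _ ⟨u, hu, u', hu', rfl⟩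
    obtain ⟨j, hj⟩ := hg u hu
    obtain ⟨j', hj'⟩ := hg u' hu'
    refine ⟨g j - g j', ⟨j, j', rfl⟩, ?_⟩
    simp [hj, hj']
  have : Nonempty E := ⟨e₀⟩
  obtain ⟨F, hF, hFC, hFx⟩ := exists_convex_contDiff_of_span_eq_top hmax hex' hcw' hspan
  have hC : ContDiff ℝ 1 fun y => F (P y) + ⟪v, y⟫_ℝ :=
    (hFC.comp P.contDiff).add (innerSL ℝ v).contDiff
  have hval : ∀ e : E, F (P e) + ⟪v, (e : EuclideanSpace ℝ (Fin n))⟫_ℝ = f e := fun e => by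
    have h1 : F (P e) = _ := (hFx e).1
    rw [h1, hself]
    ring
  refine ⟨fun y => F (P y) + ⟪v, y⟫_ℝ, ?_, hC, hval, fun e => ?_⟩
  · exact (hF.comp_linearMap P.toLinearMap).add (((innerₛₗ ℝ) v).convexOn convex_univ)
  · refine (hasGradientAt_of_forall_le (hC.differentiable one_ne_zero _) fun y => ?_).gradient
    have h1 := add_inner_gradient_le hF (hFC.differentiable one_ne_zero) (x e) (P y)
    rw [(hFx e).2.gradient, ← map_sub, hginl] at h1
    have h2 : ⟪v, y - e⟫_ℝ = ⟪v, y⟫_ℝ - ⟪v, (e : EuclideanSpace ℝ (Fin n))⟫_ℝ := inner_sub_right _ _ _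
    change F (P e) + _ + _ ≤ F (P y) + _
    change F (P e) + _ ≤ _ at h1
    linarith

theorem AddedJets.exists_gap {f : E → ℝ} {G : E → EuclideanSpace ℝ (Fin n)}
    {X : Submodule ℝ (EuclideanSpace ℝ (Fin n))} {m : ℕ} {p : Fin m → EuclideanSpace ℝ (Fin n)}
    {β : Fin m → ℝ} {w : Fin m → EuclideanSpace ℝ (Fin n)} (h : AddedJets f G X p β w) (N : ℕ) :
    ∃ c > 0, ∀ x : E, ‖X.starProjection (x : EuclideanSpace ℝ (Fin n))‖ ≤ N →
      ∀ j, β j - ⟪w j, p j⟫_ℝ + ⟪w j, (x : EuclideanSpace ℝ (Fin n))⟫_ℝ + c ≤ f x := by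
  obtain ⟨c, hc, hlt⟩ := EReal.lt_iff_exists_real_btwn.1 (h.cond_d N)
  refine ⟨c, EReal.coe_pos.1 hc, fun x hx j => ?_⟩
  have h1 := EReal.coe_le_coe_iff.1 (hlt.le.trans (iInf_le _ ⟨x, hx⟩))
  have h2 := le_ciSup (f := fun j => β j + ⟪w j, (x : EuclideanSpace ℝ (Fin n)) - p j⟫_ℝ)
    (finite_range _).bddAbove j
  simp only [inner_sub_right] at h1 h2
  linarith

theorem hasConvexC1Extension_of_admissibleSubspace {f : E → ℝ} {G : E → EuclideanSpace ℝ (Fin n)}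
    (hconv : ConvexityIneq f G) (hex : CondEX f G) {X : Submodule ℝ (EuclideanSpace ℝ (Fin n))}
    (hX : AdmissibleSubspace f G X) (hcw : SequentialCW1 f G X) : HasConvexC1Extension f G := by
  rcases isEmpty_or_nonempty E with hE | ⟨⟨e₀⟩⟩
  · exact ⟨fun _ => 0, convexOn_const 0 convex_univ, contDiff_const, fun x => isEmptyElim x,
      fun x => isEmptyElim x⟩
  obtain ⟨-, heq | ⟨p, β, w, h⟩⟩ := hX
  · refine hasConvexC1Extension_of_affine e₀ hconv hex hcw (κ := Empty) Empty.elim Empty.elim ?_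
      fun N => ⟨1, one_pos, fun x _ j => j.elim⟩
    rw [range_eq_empty (Empty.elim : Empty → EuclideanSpace ℝ (Fin n)), union_empty, heq]
  · exact hasConvexC1Extension_of_affine e₀ hconv hex hcw _ w h.cond_a h.exists_gap

end Jets

end ConvexJet

theorem mainTheorem2 (n : ℕ) (E : Set (EuclideanSpace ℝ (Fin n)))
    (f : E → ℝ) (G : E → EuclideanSpace ℝ (Fin n)) :
    ConvexJet.HasConvexC1Extension f G ↔
      (Continuous G ∧ ConvexJet.ConvexityIneq f G) ∧
      ConvexJet.CondEX f G ∧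
      ∃ X : Submodule ℝ (EuclideanSpace ℝ (Fin n)),
        ConvexJet.AdmissibleSubspace f G X ∧ ConvexJet.SequentialCW1 f G X := by
  refine ⟨?_, fun ⟨⟨_, hconv⟩, hex, X, hX, hcw⟩ =>
    ConvexJet.hasConvexC1Extension_of_admissibleSubspace hconv hex hX hcw⟩
  rintro ⟨F, hF, hC, hf, hG⟩
  obtain rfl : (fun e : E => F e) = f := funext hf
  obtain rfl : (fun e : E => gradient F (e : EuclideanSpace ℝ (Fin n))) = G := funext hG
  exact ⟨⟨(ConvexJet.continuous_gradient hC).comp continuous_subtype_val, fun x y =>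
    ConvexJet.add_inner_gradient_le hF (hC.differentiable one_ne_zero) y x⟩,
    fun x hx => ConvexJet.tendsto_inner_gradient_sub_div hF hC hx,
    ConvexJet.exists_admissibleSubspace_of_convexOn hF hC⟩
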